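/- Let $n,l,k\ge 0$ be integers, let $\mathcal H=\otimes^n\mathbb C^2$ be the space of $n$ qubits, and let $V\subseteq\mathcal H$ be a subspace with $\dim V=2^l$. Then $V$ is the code space $V_0$ of an orthogonal $(n,l,k)$ error correcting code if and only if $V$ is $2k$-totally entangled. Here the notions are as follows. *Entanglement.* For a unit vector $\psi\in\mathcal H^A\otimes\mathcal H^B$ (finite-dimensional Hilbert spaces), $E(\psi)=-\sum_i\lambda_i\log\lambda_i$, where the $\lambda_i$ are the eigenvalues of the reduced density matrix of $\psi$ on $\mathcal H^B$ (and $0\log 0=0$). A subspace $W\subseteq\mathcal H^A\otimes\mathcal H^B$ is *maximally entangled* if $\min\{E(\psi):\psi\in W,\ \|\psi\|=1\}=\log\min\{\dim\mathcal H^A,\dim\mathcal H^B\}$. A subspace of $\mathcal H$ is *$r$-totally entangled* if $r\le n/2$ and, for every choice of $r$ of the $n$ qubits, it is maximally entangled in $\mathcal H=\mathcal H^A\otimes\mathcal H^B$, where $\mathcal H^B=\otimes^{r}\mathbb C^2$ is the space of the chosen qubits and $\mathcal H^A=\otimes^{n-r}\mathbb C^2$ that of the others. *Codes.* For $X\in\mathrm{End}(\otimes^k\mathbb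 C^2)$ and $0\le i_0<\dots<i_{k-1}\le n-1$, let $X_{i_0\dots i_{k-1}}$ be the operator on $\mathcal H$ that acts as $X$ on the qubits $i_0,\dots,i_{k-1}$ and as the identity on the others. An *$(n,l,k)$ error correcting code* consists of an isometry $T:\otimes^l\mathbb C^2\to\mathcal H$, mutually orthogonal subspaces $V_0=T(\otimes^l\mathbb C^2),V_1,\dots,V_d$ of $\mathcal H$ (for some $d\geq 0$), and unitary isomorphisms $U_j:V_j\to V_0$ with $U_0=I$, such that for all $X$ and all $i_0<\dots<i_{k-1}$: 1. $X_{i_0\dots i_{k-1}}V_0\subseteq\bigoplus_{j=0}^dV_j$; 2. if $P_j$ is the orthogonal projection onto $V_j$, $v\in V_0$ is a unit vector and $w=P_jX_{i_0\dots i_{k-1}}v\ne0$, then $U_j(w/\|w\|)=cv$ for some $c\in\mathbb C$ with $|c|=1$. The code is *orthogonal* (non-degenerate) if the set $\Sigma$ of all distinct operators $(A_{j_0}\otimes\dots\otimes A_{j_{k-1}})_{i_0\dots i_{k-1}}$ (with $0\le j_r\le3$, $0\le i_0<\dots<i_{k-1}\le n-1$) has exactly $d+1$ elements, which can be labelled $S_0=I,S_1,\dots,S_d$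 so that $V_j=S_jV_0$ for all $j$. Here $A_0=I$, $A_1=\begin{pmatrix}1&0\\0&-1\end{pmatrix}$, $A_2=\begin{pmatrix}0&1\\1&0\end{pmatrix}$, $A_3=\begin{pmatrix}0&i\\-i&0\end{pmatrix}$ are the Pauli matrices. -/

import Mathlib

noncomputable section

/-- The Hilbert space `⊗ⁿ ℂ²` of `n` qubits, written in the computational basis: the standard basis
vectors are the bit strings `x : Fin n → Fin 2`. -/
abbrev Qubits (n : ℕ) : Type := EuclideanSpace ℂ (Fin n → Fin 2)

namespace Bipartite

/-- The reduced density matrix of `φ ∈ ℂ^α ⊗ ℂ^β` on the second factor: writing `φ = ∑ j, φ_j ⊗ e_j`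
with `φ_j ∈ ℂ^α` and `(e_j)` the standard basis of `ℂ^β`, it is the matrix `[⟪φ_i, φ_j⟫]`. -/
def reducedDensity {α β : Type*} [Fintype α] (φ : EuclideanSpace ℂ (α × β)) : Matrix β β ℂ :=
  Matrix.gram ℂ (fun j : β => (WithLp.toLp 2 (fun a : α => φ (a, j)) : EuclideanSpace ℂ α))

theorem reducedDensity_isHermitian {α β : Type*} [Fintype α]
    (φ : EuclideanSpace ℂ (α × β)) :
    (reducedDensity φ).IsHermitian :=
  Matrix.isHermitian_gram ℂ _

/-- The entropy of entanglement `E(φ) = - ∑ λ_i log λ_i`, where `λ_i` are the eigenvalues of the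
reduced density matrix, with multiplicity, and `0 log 0 = 0`. -/
def entanglementEntropy {α β : Type*} [Fintype α] [Fintype β] [DecidableEq β]
    (φ : EuclideanSpace ℂ (α × β)) : ℝ :=
  ∑ i, Real.negMulLog ((reducedDensity_isHermitian φ).eigenvalues i)

/-- `e` is the entanglement of the subspace `W`, that is, the minimum of `E(ψ)` over the unit
vectors `ψ` of `W`. -/
def HasEntanglement {α β : Type*} [Fintype α] [Fintype β] [DecidableEq β]
    (W : Submodule ℂ (EuclideanSpace ℂ (α × β))) (e : ℝ) : Prop :=
  IsLeast {x : ℝ | ∃ ψ ∈ W, ‖ψ‖ = 1 ∧ entanglementEntropy ψ = x} e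

/-- `W ⊆ ℂ^α ⊗ ℂ^β` is maximally entangled: its entanglement is `log m`, where `m` is the smaller
of the two dimensions. -/
def IsMaximallyEntangled {α β : Type*} [Fintype α] [Fintype β] [DecidableEq β]
    (W : Submodule ℂ (EuclideanSpace ℂ (α × β))) : Prop :=
  HasEntanglement W (Real.log (min (Fintype.card α) (Fintype.card β) : ℕ))

end Bipartite

namespace Qubits

variable {n : ℕ}

/-- Splitting a bit string into the bits outside `s` and the bits in `s`. -/
def splitBits (s : Finset (Fin n)) :
    (Fin n → Fin 2) ≃ ({i // i ∉ s} → Fin 2) × ({i // i ∈ s} → Fin 2) :=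
  (Equiv.piEquivPiSubtypeProd (fun i => i ∈ s) (fun _ => Fin 2)).trans (Equiv.prodComm _ _)

/-- The decomposition `H = H^A ⊗ H^B`, where `H^B` is the space of the qubits in `s` and `H^A` the
space of the others. -/
def split (s : Finset (Fin n)) :
    Qubits n ≃ₗᵢ[ℂ] EuclideanSpace ℂ (({i // i ∉ s} → Fin 2) × ({i // i ∈ s} → Fin 2)) :=
  LinearIsometryEquiv.piLpCongrLeft 2 ℂ ℂ (splitBits s)

/-- `V` is `r`-totally entangled: `r ≤ n / 2`, and `V` is maximally entangled relative to every
decomposition of the `n` qubits into `r` qubits and the remaining `n - r`. -/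
def IsTotallyEntangled (r : ℕ) (V : Submodule ℂ (Qubits n)) : Prop :=
  2 * r ≤ n ∧ ∀ s : Finset (Fin n), s.card = r →
    Bipartite.IsMaximallyEntangled (V.map (split s).toLinearEquiv.toLinearMap)

/-- The matrix of the operator `X_{i₀ … i_{k-1}}` on `n` qubits: `X` acts on the qubits
`i₀ < ⋯ < i_{k-1}` (with `i r = i_r`), and the identity on all the others. -/
def onQubits {k : ℕ} (i : Fin k ↪o Fin n) (X : Matrix (Fin k → Fin 2) (Fin k → Fin 2) ℂ) :
    Matrix (Fin n → Fin 2) (Fin n → Fin 2) ℂ :=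
  (Matrix.kronecker X
      (1 : Matrix ({p : Fin n // ∀ r, i r ≠ p} → Fin 2) ({p : Fin n // ∀ r, i r ≠ p} → Fin 2) ℂ)
    ).submatrix (fun x => (fun r => x (i r), fun p => x p.1))
      (fun x => (fun r => x (i r), fun p => x p.1))

/-- A matrix as an operator on `n` qubits. -/
abbrev op (M : Matrix (Fin n → Fin 2) (Fin n → Fin 2) ℂ) : Qubits n →ₗ[ℂ] Qubits n :=
  Matrix.toEuclideanLin M

/-- The Pauli basis `A₀ = I, A₁, A₂, A₃` of the `2 × 2` matrices. -/
def pauli : Fin 4 → Matrix (Fin 2) (Fin 2) ℂ :=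
  ![1, !![1, 0; 0, -1], !![0, 1; 1, 0], !![0, Complex.I; -Complex.I, 0]]

/-- The tensor product `A_{j₀} ⊗ ⋯ ⊗ A_{j_{k-1}}`. -/
def pauliTensor {k : ℕ} (j : Fin k → Fin 4) : Matrix (Fin k → Fin 2) (Fin k → Fin 2) ℂ :=
  Matrix.of fun x y => ∏ r, pauli (j r) (x r) (y r)

/-- The set `Σ` of all operators `(A_{j₀} ⊗ ⋯ ⊗ A_{j_{k-1}})_{i₀ … i_{k-1}}` on `n` qubits. -/
def pauliErrors (n k : ℕ) : Set (Matrix (Fin n → Fin 2) (Fin n → Fin 2) ℂ) :=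
  {M | ∃ (i : Fin k ↪o Fin n) (j : Fin k → Fin 4), M = onQubits i (pauliTensor j)}

/-- An `(n, l, k)` error correcting code, with syndrome subspaces `V 0, …, V d`. -/
structure ErrorCorrectingCode (n l k d : ℕ) where
  /-- the encoding isometry -/
  T : Qubits l →ₗᵢ[ℂ] Qubits n
  /-- the code space `V 0` and the syndrome subspaces -/
  V : Fin (d + 1) → Submodule ℂ (Qubits n)
  V_zero : V 0 = LinearMap.range T.toLinearMap
  orthogonal : Pairwise fun a b => V a ⟂ V b
  /-- the recovery isometries -/
  U : ∀ j, V j ≃ₗᵢ[ℂ] V 0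
  U_zero : U 0 = LinearIsometryEquiv.refl ℂ (V 0)
  /-- an error on `k` qubits maps the code space into the sum of all the `V j` -/
  error_mem : ∀ (i : Fin k ↪o Fin n) (X : Matrix (Fin k → Fin 2) (Fin k → Fin 2) ℂ),
    ∀ v ∈ V 0, op (onQubits i X) v ∈ ⨆ j, V j
  /-- if the component of the damaged state in `V j` is non-zero, then normalizing it and applying
  `U j` gives the original state up to a phase -/
  recovery : ∀ (i : Fin k ↪o Fin n) (X : Matrix (Fin k → Fin 2) (Fin k → Fin 2) ℂ),
    ∀ v ∈ V 0, ‖v‖ = 1 → ∀ j, (V j).orthogonalProjectionOnto (op (onQubits i X) v) ≠ 0 →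
      ∃ c : ℂ, ‖c‖ = 1 ∧
        (U j (((‖(V j).orthogonalProjectionOnto (op (onQubits i X) v)‖⁻¹ : ℝ) : ℂ) •
          (V j).orthogonalProjectionOnto (op (onQubits i X) v)) : Qubits n) = c • v

/-- The code is orthogonal (non-degenerate): the distinct elements of `Σ` can be labelled
`S 0 = I, S 1, …, S d` in such a way that `V j = S j (V 0)` for all `j`. -/
def ErrorCorrectingCode.IsOrthogonal {n l k d : ℕ} (C : ErrorCorrectingCode n l k d) : Prop :=
  ∃ S : Fin (d + 1) → Matrix (Fin n → Fin 2) (Fin n → Fin 2) ℂ,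
    Function.Injective S ∧ Set.range S = pauliErrors n k ∧ S 0 = 1 ∧
      ∀ j, C.V j = (C.V 0).map (op (S j))

end Qubits

end

/-! Both conditions are equivalent to a third: `⟪v, P v⟫ = 0` for every `v` in `V` and every
non-identity Pauli string `P` of weight at most `2 * k`. By the equality case of Jensen's
inequality, a unit vector has entropy `log (dim H^B)` only if its reduced density matrix is scalar
(`reducedDensity_eq_of_log_card_le`). Since Pauli strings form a trace-orthogonal basis, this holds
exactly when all non-identity Pauli expectations on those qubits vanish
(`reducedDensity_eq_smul_one_of_inner`, `inner_op_tensor_of_reducedDensity_eq`). On the code side,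
Pauli strings of weight at most `2 * k` split into two of weight at most `k`
(`exists_pauliString_mul_eq`), so orthogonality of the syndromes `S_j V` kills these expectations.
Conversely, polarization (`inner_map_eq_zero_of_mem`) turns vanishing expectations into
orthogonality of the `S_j V`. An arbitrary error is a combination of the `S_j`, and each involution
`S_j` serves as its own recovery. -/

namespace Bipartite

/-! ### Reduced density matrices and entropy. -/

variable {α β : Type*} [Fintype α]

theorem reducedDensity_apply (φ : EuclideanSpace ℂ (α × β)) (i j : β) :
    reducedDensity φ i j = ∑ a, star (φ (a, i)) * φ (a, j) := by
  simp [reducedDensity, Matrix.gram_apply, PiLp.inner_apply, mul_comm]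

variable [Fintype β]

theorem trace_reducedDensity (φ : EuclideanSpace ℂ (α × β)) :
    (reducedDensity φ).trace = ((‖φ‖ ^ 2 : ℝ) : ℂ) := by
  have h : (inner ℂ φ φ : ℂ) = ((‖φ‖ ^ 2 : ℝ) : ℂ) := by
    rw [inner_self_eq_norm_sq_to_K]; norm_cast
  rw [← h, PiLp.inner_apply, Fintype.sum_prod_type_right]
  simp [Matrix.trace, reducedDensity_apply, mul_comm, Complex.mul_conj, Complex.normSq_eq_norm_sq]

variable [DecidableEq β]

theorem sum_eigenvalues_reducedDensity (φ : EuclideanSpace ℂ (α × β)) (hφ : ‖φ‖ = 1) :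
    ∑ i, (reducedDensity_isHermitian φ).eigenvalues i = 1 := by
  have h := (reducedDensity_isHermitian φ).trace_eq_sum_eigenvalues
  rw [trace_reducedDensity, hφ] at h
  have h' : ((∑ i, (reducedDensity_isHermitian φ).eigenvalues i : ℝ) : ℂ) = ((1 : ℝ) : ℂ) := by
    push_cast; simpa using h.symm
  exact_mod_cast h'

theorem reducedDensity_eq_smul_one_of_eigenvalues {φ : EuclideanSpace ℂ (α × β)} {c : ℝ}
    (h : ∀ i, (reducedDensity_isHermitian φ).eigenvalues i = c) :
    reducedDensity φ = (c : ℂ) • (1 : Matrix β β ℂ) := by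
  have hs := (reducedDensity_isHermitian φ).spectral_theorem
  have hd : Matrix.diagonal
      (RCLike.ofReal ∘ (reducedDensity_isHermitian φ).eigenvalues : β → ℂ) =
      (c : ℂ) • (1 : Matrix β β ℂ) := by
    ext i j
    by_cases hij : i = j <;> simp [hij, h]
  rw [hd, map_smul, map_one] at hs
  exact hs

theorem eigenvalues_of_reducedDensity_eq_smul_one {φ : EuclideanSpace ℂ (α × β)} {c : ℝ}
    (h : reducedDensity φ = (c : ℂ) • (1 : Matrix β β ℂ)) (i : β) :
    (reducedDensity_isHermitian φ).eigenvalues i = c := by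
  have hm := (reducedDensity_isHermitian φ).eigenvalues_mem_spectrum_real i
  have hs : spectrum ℝ (reducedDensity φ) = {c} := by
    have : Nonempty β := ⟨i⟩
    rw [h, show ((c : ℂ) • (1 : Matrix β β ℂ)) = algebraMap ℝ (Matrix β β ℂ) c by
      ext a b; simp [Matrix.algebraMap_matrix_apply, Matrix.one_apply], spectrum.scalar_eq]
  rwa [hs] at hm

theorem entanglementEntropy_of_reducedDensity_eq [Nonempty β] {φ : EuclideanSpace ℂ (α × β)}
    (h : reducedDensity φ = (((Fintype.card β : ℝ)⁻¹ : ℝ) : ℂ) • (1 : Matrix β β ℂ)) :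
    entanglementEntropy φ = Real.log (Fintype.card β) := by
  have hc : (Fintype.card β : ℝ) ≠ 0 := by exact_mod_cast Fintype.card_ne_zero
  simp only [entanglementEntropy, eigenvalues_of_reducedDensity_eq_smul_one h, Real.negMulLog,
    Finset.sum_const, Finset.card_univ, nsmul_eq_mul, Real.log_inv]
  field_simp

/-- A unit vector whose entropy of entanglement attains `log (dim H^B)` has maximally mixed reduced
density matrix. -/
theorem reducedDensity_eq_of_log_card_le [Nonempty β] {φ : EuclideanSpace ℂ (α × β)}
    (hφ : ‖φ‖ = 1) (h : Real.log (Fintype.card β) ≤ entanglementEntropy φ) :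
    reducedDensity φ = (((Fintype.card β : ℝ)⁻¹ : ℝ) : ℂ) • (1 : Matrix β β ℂ) := by
  have hc : (0 : ℝ) < Fintype.card β := by exact_mod_cast Fintype.card_pos
  have hsum := sum_eigenvalues_reducedDensity φ hφ
  set ev := (reducedDensity_isHermitian φ).eigenvalues with hev
  have hnn (i) : 0 ≤ ev i :=
    (Matrix.posSemidef_gram ℂ
      (fun j : β => (WithLp.toLp 2 (fun a : α => φ (a, j)) : EuclideanSpace ℂ α))).eigenvalues_nonneg i
  -- Equality in Jensen's inequality with uniform weights: strict concavity of `negMulLog` forces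
  -- equal eigenvalues.
  have heq : ∀ i ∈ Finset.univ, ∀ j ∈ Finset.univ, ev i = ev j := by
    refine fun i hi j hj => Real.strictConcaveOn_negMulLog.eq_of_map_sum_eq (t := Finset.univ)
      (w := fun _ => (Fintype.card β : ℝ)⁻¹) (p := ev) (fun _ _ => inv_pos.2 hc)
      (by simp [hc.ne']) (fun i _ => hnn i) ?_ hi hj
    simp only [smul_eq_mul, ← Finset.mul_sum, hsum, mul_one]
    rw [Real.negMulLog, Real.log_inv, neg_mul_neg]
    exact mul_le_mul_of_nonneg_left h (inv_pos.2 hc).le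
  refine reducedDensity_eq_smul_one_of_eigenvalues fun i => ?_
  have : ∑ j, ev j = Fintype.card β * ev i := by
    rw [Finset.sum_congr rfl fun j hj => heq j hj i (Finset.mem_univ i)]
    simp
  rw [this] at hsum
  exact eq_inv_of_mul_eq_one_right hsum

/-- If the reduced density matrix on `H^B` is invertible, then `dim H^B ≤ dim H^A`. -/
theorem card_le_card_of_reducedDensity_eq {φ : EuclideanSpace ℂ (α × β)} {c : ℂ} (hc : c ≠ 0)
    (h : reducedDensity φ = c • (1 : Matrix β β ℂ)) : Fintype.card β ≤ Fintype.card α := by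
  have hli := Matrix.linearIndependent_of_det_gram_ne_zero (𝕜 := ℂ)
    (v := fun j : β => (WithLp.toLp 2 (fun a : α => φ (a, j)) : EuclideanSpace ℂ α)) (by
      change (reducedDensity φ).det ≠ 0
      rw [h, Matrix.det_smul, Matrix.det_one, mul_one]
      exact pow_ne_zero _ hc)
  simpa using hli.fintype_card_le_finrank

end Bipartite

/-! ### Pauli matrices and their tensor products. -/

namespace Qubits

theorem pauli_zero : pauli 0 = 1 := rfl

theorem pauli_mul_self (a : Fin 4) : pauli a * pauli a = 1 := by
  fin_cases a <;> ext i j <;> fin_cases i <;> fin_cases j <;>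
    simp [pauli, Matrix.mul_apply, Fin.sum_univ_two]

theorem pauli_isHermitian (a : Fin 4) : (pauli a).IsHermitian := by
  fin_cases a <;> ext i j <;> fin_cases i <;> fin_cases j <;>
    simp [pauli]

theorem trace_pauli_mul (a b : Fin 4) : (pauli a * pauli b).trace = if a = b then 2 else 0 := by
  fin_cases a <;> fin_cases b <;>
    simp [pauli, Matrix.trace, Fin.sum_univ_two] <;> norm_num

theorem sum_pauli_mul_pauli (x y x' y' : Fin 2) :
    ∑ a, pauli a x y * pauli a y' x' = if x = x' ∧ y = y' then 2 else 0 := by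
  fin_cases x <;> fin_cases y <;> fin_cases x' <;> fin_cases y' <;>
    simp [pauli, Fin.sum_univ_four] <;> norm_num

section Tensor

variable {ι : Type*} [Fintype ι]

/-- The tensor product of a family of one-qubit matrices. -/
def tensor (M : ι → Matrix (Fin 2) (Fin 2) ℂ) : Matrix (ι → Fin 2) (ι → Fin 2) ℂ :=
  Matrix.of fun x y => ∏ p, M p (x p) (y p)

theorem tensor_apply (M : ι → Matrix (Fin 2) (Fin 2) ℂ) (x y : ι → Fin 2) :
    tensor M x y = ∏ p, M p (x p) (y p) := rfl

/-- The Pauli operator acting as `A_{f p}` on the qubit `p`. -/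
def pauliString (f : ι → Fin 4) : Matrix (ι → Fin 2) (ι → Fin 2) ℂ :=
  tensor fun p => pauli (f p)

theorem tensor_one : tensor (fun _ : ι => 1) = 1 := by
  ext x y
  simp [tensor_apply, Matrix.one_apply, Finset.prod_ite_zero, funext_iff]

theorem pauliString_zero : pauliString (0 : ι → Fin 4) = 1 := tensor_one

theorem pauliString_isHermitian (f : ι → Fin 4) : (pauliString f).IsHermitian := by
  ext x y
  simp only [Matrix.conjTranspose_apply, pauliString, tensor_apply, star_prod]
  exact Finset.prod_congr rfl fun p _ => (pauli_isHermitian (f p)).apply _ _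

variable [DecidableEq ι]

theorem tensor_mul (M N : ι → Matrix (Fin 2) (Fin 2) ℂ) :
    tensor M * tensor N = tensor fun p => M p * N p := by
  ext x y
  simp only [Matrix.mul_apply, tensor_apply, ← Finset.prod_mul_distrib]
  rw [Finset.prod_univ_sum, Fintype.piFinset_univ]

theorem trace_tensor (M : ι → Matrix (Fin 2) (Fin 2) ℂ) :
    (tensor M).trace = ∏ p, (M p).trace := by
  simp only [Matrix.trace, Matrix.diag, tensor_apply]
  rw [Finset.prod_univ_sum, Fintype.piFinset_univ]

theorem pauliString_mul_self (f : ι → Fin 4) : pauliString f * pauliString f = 1 := by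
  simp only [pauliString, tensor_mul, pauli_mul_self, tensor_one]

/-- The trace of a product factorizes over qubits, so it vanishes once two labels differ, whereas a
square has trace `2 ^ card ι`. -/
theorem pauliString_injective : Function.Injective (pauliString : (ι → Fin 4) → _) := by
  intro f g h
  have h1 : (pauliString f * pauliString g).trace ≠ 0 := by
    rw [h, pauliString_mul_self, Matrix.trace_one]
    simp
  rw [pauliString, pauliString, tensor_mul, trace_tensor] at h1
  funext p
  have := Finset.prod_ne_zero_iff.1 h1 p (Finset.mem_univ p)
  rw [trace_pauli_mul] at this
  by_contra hp
  simp [hp] at this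

/-- The completeness relation of the Pauli operators. -/
theorem sum_pauliString_mul_pauliString (x y x' y' : ι → Fin 2) :
    ∑ f, pauliString f x y * pauliString f y' x' =
      if x = x' ∧ y = y' then 2 ^ Fintype.card ι else 0 := by
  have h : ∑ f : ι → Fin 4, pauliString f x y * pauliString f y' x' =
      ∏ p, ∑ a, pauli a (x p) (y p) * pauli a (y' p) (x' p) := by
    rw [Finset.prod_univ_sum, Fintype.piFinset_univ]
    simp only [pauliString, tensor_apply, Finset.prod_mul_distrib]
  rw [h]
  simp only [sum_pauli_mul_pauli]
  rw [Finset.prod_ite_zero]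
  simp [funext_iff, forall_and]

/-- Every operator is a linear combination of Pauli operators. -/
theorem mem_span_pauliString (X : Matrix (ι → Fin 2) (ι → Fin 2) ℂ) :
    X ∈ Submodule.span ℂ (Set.range (pauliString : (ι → Fin 4) → _)) := by
  rw [Submodule.mem_span_range_iff_exists_fun]
  -- The coefficient is the normalized trace of `pauliString f * X`.
  refine ⟨fun f => (2 ^ Fintype.card ι)⁻¹ * ∑ x, ∑ y, pauliString f x y * X y x, ?_⟩
  ext a b
  simp only [Matrix.sum_apply, Matrix.smul_apply, smul_eq_mul, mul_assoc, ← Finset.mul_sum,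
    Finset.sum_mul]
  rw [Finset.sum_comm]
  have h (x y : ι → Fin 2) : ∑ f : ι → Fin 4, pauliString f x y * (X y x * pauliString f a b) =
      X y x * if x = b ∧ y = a then 2 ^ Fintype.card ι else 0 := by
    rw [← sum_pauliString_mul_pauliString, Finset.mul_sum]
    exact Finset.sum_congr rfl fun f _ => by ring
  have h' (x : ι → Fin 2) : ∑ f : ι → Fin 4, ∑ y, pauliString f x y * (X y x * pauliString f a b) =
      if x = b then X a b * 2 ^ Fintype.card ι else 0 := by
    rw [Finset.sum_comm]
    simp only [h]
    by_cases hx : x = b <;> simp [hx]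
  simp only [h']
  simp [mul_comm]

end Tensor

end Qubits

/-! ### Pauli expectations and reduced density matrices. -/

namespace Qubits

variable {n : ℕ}

open Bipartite

theorem tensor_splitBits_symm {s : Finset (Fin n)} {M : Fin n → Matrix (Fin 2) (Fin 2) ℂ}
    (hM : ∀ p ∉ s, M p = 1) (a a' : {i // i ∉ s} → Fin 2) (b b' : {i // i ∈ s} → Fin 2) :
    tensor M ((splitBits s).symm (a, b)) ((splitBits s).symm (a', b')) =
      if a = a' then tensor (fun p : {i // i ∈ s} => M p) b b' else 0 := by
  have hB : ∏ p : {i // i ∈ s}, M p ((splitBits s).symm (a, b) p) ((splitBits s).symm (a', b') p) =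
      tensor (fun p : {i // i ∈ s} => M p) b b' := by
    refine Finset.prod_congr rfl fun p _ => ?_
    simp [splitBits, Equiv.piEquivPiSubtypeProd, p.2]
  have hA : ∏ p : {i // i ∉ s}, M p ((splitBits s).symm (a, b) p) ((splitBits s).symm (a', b') p) =
      if a = a' then 1 else 0 := by
    rw [Finset.prod_congr rfl fun p _ => by
      rw [hM p.1 p.2, Matrix.one_apply]]
    simp only [Finset.prod_ite_zero, Finset.prod_const_one, funext_iff]
    congr 1
    simp only [Finset.mem_univ, true_imp_iff, eq_iff_iff]
    refine forall_congr' fun p => ?_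
    simp [splitBits, Equiv.piEquivPiSubtypeProd, p.2]
  rw [tensor_apply, ← Fintype.prod_subtype_mul_prod_subtype (fun p => p ∈ s)]
  refine (congrArg₂ (· * ·) ?_ hA).trans (b := tensor (fun p : {i // i ∈ s} => M p) b b' * _) ?_
  · convert hB
  · simp

/-- The expectation of a product operator supported on the qubits of `s` is computed by the reduced
density matrix on those qubits. -/
theorem inner_op_tensor {s : Finset (Fin n)} {M : Fin n → Matrix (Fin 2) (Fin 2) ℂ}
    (hM : ∀ p ∉ s, M p = 1) (v : Qubits n) :
    inner ℂ v (op (tensor M) v) =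
      ∑ b, ∑ b', tensor (fun p : {i // i ∈ s} => M p) b b' * reducedDensity (split s v) b b' := by
  have hv (a b) : split s v (a, b) = v ((splitBits s).symm (a, b)) := rfl
  have h1 : inner ℂ v (op (tensor M) v) = ∑ x, ∑ y, star (v x) * (tensor M x y * v y) := by
    simp [PiLp.inner_apply, Matrix.mulVec, dotProduct, Matrix.toLpLin_apply, Finset.mul_sum,
      mul_comm]
  rw [h1, ← (splitBits s).symm.sum_comp, Fintype.sum_prod_type_right]
  refine Finset.sum_congr rfl fun b _ => ?_
  simp only [reducedDensity_apply, hv, Finset.mul_sum]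
  rw [Finset.sum_comm (s := (Finset.univ : Finset ({i // i ∈ s} → Fin 2)))]
  refine Finset.sum_congr rfl fun a _ => ?_
  rw [← (splitBits s).symm.sum_comp, Fintype.sum_prod_type_right]
  refine Finset.sum_congr rfl fun b' _ => ?_
  simp only [tensor_splitBits_symm hM]
  simp
  ring

/-- The Pauli coefficients of the reduced density matrix are expectations in `v`: only the identity
survives, and its coefficient is fixed by the unit trace. -/
theorem reducedDensity_eq_smul_one_of_inner {s : Finset (Fin n)} {v : Qubits n} (hv : ‖v‖ = 1)
    (h : ∀ f : Fin n → Fin 4, f ≠ 0 → (∀ p ∉ s, f p = 0) → inner ℂ v (op (pauliString f) v) = 0) :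
    reducedDensity (split s v) =
      (((Fintype.card ({i // i ∈ s} → Fin 2) : ℝ)⁻¹ : ℝ) : ℂ) • 1 := by
  set ρ := reducedDensity (split s v) with hρ
  -- The Gram convention makes `ρ` the transpose of the usual density matrix, so entries are paired
  -- without swapping indices.
  have key (g : {i // i ∈ s} → Fin 4) :
      ∑ b, ∑ b', pauliString g b b' * ρ b b' = if g = 0 then 1 else 0 := by
    split_ifs with hg
    · have : ρ.trace = 1 := by rw [hρ, trace_reducedDensity, LinearIsometryEquiv.norm_map, hv]; simp
      rw [hg, pauliString_zero, ← this]
      simp [Matrix.one_apply, Matrix.trace]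
    · have h0 := h (fun p => if hp : p ∈ s then g ⟨p, hp⟩ else 0)
        (fun h0 => hg <| funext fun p => by simpa [p.2] using congrFun h0 p.1)
        (fun p hp => by simp [hp])
      rw [pauliString, inner_op_tensor (s := s) (fun p hp => by simp [hp, pauli_zero])] at h0
      simpa [pauliString] using h0
  ext b b'
  -- One sum evaluated twice: by completeness here, by `key` in `h2`.
  have h1 : ∑ x, ∑ y, (∑ f : {i // i ∈ s} → Fin 4, pauliString f x y * pauliString f b' b) * ρ x y =
      2 ^ Fintype.card {i // i ∈ s} * ρ b b' := by
    simp only [sum_pauliString_mul_pauliString]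
    rw [Finset.sum_eq_single b, Finset.sum_eq_single b'] <;> simp +contextual
  have h2 : ∑ x, ∑ y, (∑ f : {i // i ∈ s} → Fin 4, pauliString f x y * pauliString f b' b) * ρ x y =
      (1 : Matrix _ _ ℂ) b b' := by
    have h3 : ∑ f : {i // i ∈ s} → Fin 4, (∑ x, ∑ y, pauliString f x y * ρ x y) * pauliString f b' b
        = (1 : Matrix _ _ ℂ) b b' := by
      simp only [key]
      simp [pauliString_zero, Matrix.one_apply, eq_comm]
    rw [← h3]
    simp only [Finset.sum_mul]
    conv_rhs => rw [Finset.sum_comm]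
    refine Finset.sum_congr rfl fun x _ => ?_
    rw [Finset.sum_comm]
    exact Finset.sum_congr rfl fun f _ => Finset.sum_congr rfl fun y _ => by ring
  rw [h2] at h1
  rw [Matrix.smul_apply, h1]
  simp

/-- Against a scalar density matrix an expectation is a multiple of the trace, which one traceless
factor kills. General factors are allowed because a product of Pauli matrices is a Pauli matrix only
up to phase. -/
theorem inner_op_tensor_of_reducedDensity_eq {s : Finset (Fin n)} {v : Qubits n} {c : ℂ}
    (h : reducedDensity (split s v) = c • 1) {M : Fin n → Matrix (Fin 2) (Fin 2) ℂ}
    (hM : ∀ p ∉ s, M p = 1) (hs : ∃ p ∈ s, (M p).trace = 0) :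
    inner ℂ v (op (tensor M) v) = 0 := by
  obtain ⟨p, hp, hp0⟩ := hs
  have ht : (tensor fun p : {i // i ∈ s} => M p).trace = 0 := by
    rw [trace_tensor]
    exact Finset.prod_eq_zero (Finset.mem_univ ⟨p, hp⟩) hp0
  rw [inner_op_tensor hM, h]
  simp [Matrix.one_apply, ← Finset.sum_mul]
  exact Or.inl ht

/-- Complex polarization, after rescaling to remove the unit norm. -/
theorem inner_map_eq_zero_of_mem {E : Type*} [NormedAddCommGroup E] [InnerProductSpace ℂ E]
    {V : Submodule ℂ E} {A : E →ₗ[ℂ] E} (h : ∀ v ∈ V, ‖v‖ = 1 → inner ℂ v (A v) = 0)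
    {v w : E} (hv : v ∈ V) (hw : w ∈ V) : inner ℂ v (A w) = 0 := by
  have h' : ∀ v ∈ V, inner ℂ (A v) v = 0 := by
    intro v hv
    rcases eq_or_ne v 0 with rfl | hv0
    · simp
    have hn : ((‖v‖ : ℝ) : ℂ) ≠ 0 := by exact_mod_cast norm_ne_zero_iff.2 hv0
    have := h (((‖v‖ : ℂ)⁻¹) • v) (V.smul_mem _ hv) (norm_smul_inv_norm hv0)
    rw [map_smul, inner_smul_left, inner_smul_right] at this
    have h0 : inner ℂ v (A v) = 0 := by simpa [hn] using this
    rw [← inner_conj_symm, h0, map_zero]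
  rw [← inner_conj_symm, inner_map_polarization]
  have hI := V.smul_mem Complex.I hv
  have hI' := V.smul_mem Complex.I hw
  rw [h' _ (V.add_mem hv hw), h' _ (V.sub_mem hv hw), h' _ (V.add_mem hv hI'),
    h' _ (V.sub_mem hv hI')]
  simp

theorem inner_op_left {M : Matrix (Fin n → Fin 2) (Fin n → Fin 2) ℂ} (hM : M.IsHermitian)
    (v w : Qubits n) : inner ℂ (op M v) w = inner ℂ v (op M w) := by
  have := Matrix.toEuclideanLin_conjTranspose_eq_adjoint M
  rw [hM.eq] at this
  conv_rhs => rw [op, this, LinearMap.adjoint_inner_right]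

theorem op_mul_apply (M N : Matrix (Fin n → Fin 2) (Fin n → Fin 2) ℂ) (v : Qubits n) :
    op (M * N) v = op M (op N v) := by
  simp [op, Matrix.toLpLin_mul_same]

theorem op_pauliString_op (f : Fin n → Fin 4) (v : Qubits n) :
    op (pauliString f) (op (pauliString f) v) = v := by
  rw [← op_mul_apply, pauliString_mul_self]
  simp

theorem norm_op_pauliString (f : Fin n → Fin 4) (v : Qubits n) :
    ‖op (pauliString f) v‖ = ‖v‖ := by
  rw [@norm_eq_sqrt_re_inner ℂ, @norm_eq_sqrt_re_inner ℂ _ _ _ _ v,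
    inner_op_left (pauliString_isHermitian f), op_pauliString_op]

/-! ### Pauli errors as Pauli strings of bounded weight. -/

section Errors

variable {k : ℕ}

theorem onQubits_pauliTensor (i : Fin k ↪o Fin n) (j : Fin k → Fin 4) :
    onQubits i (pauliTensor j) = pauliString (Function.extend i j 0) := by
  ext x y
  rw [pauliString, tensor_apply, ← Finset.prod_mul_prod_compl (Finset.univ.map i.toEmbedding),
    Finset.prod_map]
  have h : ∏ p ∈ (Finset.univ.map i.toEmbedding)ᶜ, pauli (Function.extend i j 0 p) (x p) (y p) =
      if ∀ p ∈ (Finset.univ.map i.toEmbedding)ᶜ, x p = y p then 1 else 0 := by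
    rw [Finset.prod_congr rfl fun p hp => by
      rw [Function.extend_apply' _ _ _ (by simpa using hp), Pi.zero_apply, pauli_zero,
        Matrix.one_apply], Finset.prod_ite_zero]
    simp
  rw [h]
  simp [onQubits, pauliTensor, Matrix.one_apply, funext_iff, i.injective.extend_apply]

/-- The number of qubits on which a Pauli operator acts non-trivially. -/
def weight (f : Fin n → Fin 4) : ℕ := (Finset.univ.filter fun p => f p ≠ 0).card

theorem weight_extend_le (i : Fin k ↪o Fin n) (j : Fin k → Fin 4) :
    weight (Function.extend i j 0) ≤ k := by
  calc weight (Function.extend i j 0) ≤ (Finset.univ.map i.toEmbedding).card := by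
        refine Finset.card_le_card fun p hp => ?_
        by_contra h
        exact (Finset.mem_filter.1 hp).2 (Function.extend_apply' _ _ _ (by simpa using h))
    _ = k := by simp

theorem pauliString_mem_pauliErrors (hk : k ≤ n) {f : Fin n → Fin 4} (hf : weight f ≤ k) :
    pauliString f ∈ pauliErrors n k := by
  obtain ⟨t, hft, -, ht⟩ := Finset.exists_subsuperset_card_eq (Finset.subset_univ _) hf
    (by simpa using hk)
  refine ⟨t.orderEmbOfFin ht, fun r => f (t.orderEmbOfFin ht r), ?_⟩
  rw [onQubits_pauliTensor]
  congr 1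
  funext p
  by_cases hp : p ∈ t
  · rw [← Finset.mem_coe, ← Finset.range_orderEmbOfFin t ht] at hp
    obtain ⟨r, rfl⟩ := hp
    rw [(t.orderEmbOfFin ht).injective.extend_apply]
  · rw [Function.extend_apply' _ _ _ fun ⟨r, hr⟩ => hp (hr ▸ Finset.orderEmbOfFin_mem t ht r)]
    by_contra h
    exact hp (hft (by simpa using h))

/-- Identity factors among the `k` chosen qubits produce the smaller weights; `k ≤ n` lets a small
support be padded to exactly `k` qubits. -/
theorem pauliErrors_eq (hk : k ≤ n) :
    pauliErrors n k = pauliString '' {f : Fin n → Fin 4 | weight f ≤ k} := by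
  ext M
  constructor
  · rintro ⟨i, j, rfl⟩
    exact ⟨_, weight_extend_le i j, (onQubits_pauliTensor i j).symm⟩
  · rintro ⟨f, hf, rfl⟩
    exact pauliString_mem_pauliErrors hk hf

theorem onQubits_mem_span (i : Fin k ↪o Fin n) (X : Matrix (Fin k → Fin 2) (Fin k → Fin 2) ℂ) :
    onQubits i X ∈ Submodule.span ℂ (pauliErrors n k) := by
  let L : Matrix (Fin k → Fin 2) (Fin k → Fin 2) ℂ →ₗ[ℂ]
      Matrix (Fin n → Fin 2) (Fin n → Fin 2) ℂ :=
    { toFun := onQubits i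
      map_add' := fun X Y => by ext; simp [onQubits, add_mul]
      map_smul' := fun c X => by ext; simp [onQubits, mul_assoc] }
  have h := Submodule.mem_map_of_mem (f := L) (mem_span_pauliString X)
  rw [Submodule.map_span] at h
  refine Submodule.span_mono ?_ h
  rintro _ ⟨_, ⟨j, rfl⟩, rfl⟩
  exact ⟨i, j, rfl⟩

/-- A Pauli operator of weight at most `2 k` is a product of two Pauli operators of weight at most
`k` with disjoint supports. -/
theorem exists_pauliString_mul_eq {f : Fin n → Fin 4} (hf : weight f ≤ 2 * k) :
    ∃ g h : Fin n → Fin 4, weight g ≤ k ∧ weight h ≤ k ∧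
      pauliString g * pauliString h = pauliString f := by
  set u := Finset.univ.filter fun p => f p ≠ 0 with hu
  have hu' : u.card ≤ 2 * k := hf
  obtain ⟨t, htu, ht⟩ := Finset.exists_subset_card_eq (s := u) (n := min k u.card)
    (min_le_right _ _)
  refine ⟨fun p => if p ∈ t then f p else 0, fun p => if p ∈ t then 0 else f p, ?_, ?_, ?_⟩
  · refine (Finset.card_le_card (t := t) fun p hp => ?_).trans (by omega)
    by_contra h
    simp [h] at hp
  · refine (Finset.card_le_card (t := u \ t) fun p hp => ?_).trans ?_
    · simp at hp
      simpa [hu] using hp.symm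
    · rw [Finset.card_sdiff_of_subset htu]
      omega
  · rw [pauliString, pauliString, tensor_mul, pauliString]
    congr 1
    funext p
    by_cases hp : p ∈ t <;> simp [hp, pauli_zero]

end Errors

end Qubits

/-! ### The two implications. -/

namespace Qubits

variable {n l k : ℕ}

open Bipartite

namespace ErrorCorrectingCode

variable {d : ℕ} {C : ErrorCorrectingCode n l k d}

theorem IsOrthogonal.le (hC : C.IsOrthogonal) : k ≤ n := by
  obtain ⟨S, -, hS, -, -⟩ := hC
  obtain ⟨i, -⟩ : S 0 ∈ pauliErrors n k := hS ▸ Set.mem_range_self 0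
  simpa using Fintype.card_le_of_injective i i.injective

/-- Factoring the string and moving one Hermitian factor across gives an inner product of vectors in
two syndrome spaces. These are distinct, since equal factors would multiply to the identity. -/
theorem IsOrthogonal.inner_op_pauliString (hC : C.IsOrthogonal) {f : Fin n → Fin 4} (hf0 : f ≠ 0)
    (hf : weight f ≤ 2 * k) {v : Qubits n} (hv : v ∈ C.V 0) :
    inner ℂ v (op (pauliString f) v) = 0 := by
  have hk := hC.le
  obtain ⟨S, -, hS, -, hSV⟩ := hC
  obtain ⟨g, h, hg, hh, hgh⟩ := exists_pauliString_mul_eq hf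
  obtain ⟨a, ha⟩ : pauliString g ∈ Set.range S := hS ▸ pauliString_mem_pauliErrors hk hg
  obtain ⟨b, hb⟩ : pauliString h ∈ Set.range S := hS ▸ pauliString_mem_pauliErrors hk hh
  have hab : a ≠ b := by
    rintro rfl
    rw [← ha, ← hb, ha, pauliString_mul_self, ← pauliString_zero] at hgh
    exact hf0 (pauliString_injective hgh).symm
  rw [← hgh, op_mul_apply, ← inner_op_left (pauliString_isHermitian g)]
  refine (Submodule.isOrtho_iff_inner_eq.1 (C.orthogonal hab)) _ ?_ _ ?_
  · rw [hSV a, ha]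
    exact Submodule.mem_map_of_mem hv
  · rw [hSV b, hb]
    exact Submodule.mem_map_of_mem hv

end ErrorCorrectingCode

theorem card_bits (s : Finset (Fin n)) : Fintype.card ({i // i ∈ s} → Fin 2) = 2 ^ s.card := by
  simp

theorem card_bits_compl (s : Finset (Fin n)) :
    Fintype.card ({i // i ∉ s} → Fin 2) = 2 ^ (n - s.card) := by
  simp [Fintype.card_subtype_compl]

theorem isMaximallyEntangled_of_reducedDensity_eq {s : Finset (Fin n)} (hs : 2 * s.card ≤ n)
    {V : Submodule ℂ (Qubits n)} (hV : V ≠ ⊥)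
    (h : ∀ v ∈ V, ‖v‖ = 1 → reducedDensity (split s v) =
      (((Fintype.card ({i // i ∈ s} → Fin 2) : ℝ)⁻¹ : ℝ) : ℂ) • 1) :
    IsMaximallyEntangled (V.map (split s).toLinearEquiv.toLinearMap) := by
  rw [IsMaximallyEntangled, min_eq_right (by
    rw [card_bits, card_bits_compl]; exact Nat.pow_le_pow_right two_pos (by omega))]
  refine ⟨?_, ?_⟩
  -- The minimum must be attained, so a unit vector of `V` is needed.
  · obtain ⟨v, hv, hv0⟩ := V.exists_mem_ne_zero_of_ne_bot hV
    have hn : ‖((‖v‖ : ℂ)⁻¹) • v‖ = 1 := norm_smul_inv_norm hv0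
    have hm : ((‖v‖ : ℂ)⁻¹) • v ∈ V := V.smul_mem _ hv
    exact ⟨split s _, Submodule.mem_map_of_mem hm, by rw [LinearIsometryEquiv.norm_map, hn],
      entanglementEntropy_of_reducedDensity_eq (h _ hm hn)⟩
  · rintro _ ⟨_, ⟨v, hv, rfl⟩, hn, rfl⟩
    exact (entanglementEntropy_of_reducedDensity_eq
      (h v hv (by rw [← hn]; exact ((split s).norm_map v).symm))).ge

theorem IsTotallyEntangled.reducedDensity_eq {r : ℕ} {V : Submodule ℂ (Qubits n)}
    (h : IsTotallyEntangled r V) {s : Finset (Fin n)} (hs : s.card = r) {v : Qubits n}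
    (hv : v ∈ V) (hn : ‖v‖ = 1) : reducedDensity (split s v) =
      (((Fintype.card ({i // i ∈ s} → Fin 2) : ℝ)⁻¹ : ℝ) : ℂ) • 1 := by
  have hn' : ‖split s v‖ = 1 := by rw [LinearIsometryEquiv.norm_map, hn]
  refine reducedDensity_eq_of_log_card_le hn' ?_
  have hmin := (h.2 s hs).2 ⟨split s v, Submodule.mem_map_of_mem hv, hn', rfl⟩
  rwa [min_eq_right (by
    rw [card_bits, card_bits_compl]
    exact Nat.pow_le_pow_right two_pos (by have := h.1; omega))] at hmin

theorem ErrorCorrectingCode.IsOrthogonal.isTotallyEntangled {d : ℕ}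
    {C : ErrorCorrectingCode n l k d} (hC : C.IsOrthogonal) (hV : C.V 0 ≠ ⊥) :
    IsTotallyEntangled (2 * k) (C.V 0) := by
  have hρ {s : Finset (Fin n)} (hs : s.card ≤ 2 * k) {v : Qubits n} (hv : v ∈ C.V 0)
      (hn : ‖v‖ = 1) := reducedDensity_eq_smul_one_of_inner (s := s) hn fun f hf0 hf =>
    hC.inner_op_pauliString hf0 ((Finset.card_le_card fun p hp => by
      by_contra hps
      exact (Finset.mem_filter.1 hp).2 (hf p hps)).trans hs) hv
  -- An invertible reduced density matrix forces `2 ^ s.card ≤ 2 ^ (n - s.card)`.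
  have hcard {s : Finset (Fin n)} (hs : s.card ≤ 2 * k) : 2 * s.card ≤ n := by
    obtain ⟨v, hv, hv0⟩ := (C.V 0).exists_mem_ne_zero_of_ne_bot hV
    have := card_le_card_of_reducedDensity_eq (by simp) (hρ hs ((C.V 0).smul_mem (‖v‖ : ℂ)⁻¹ hv)
      (norm_smul_inv_norm hv0))
    rw [card_bits, card_bits_compl] at this
    have := (Nat.pow_le_pow_iff_right one_lt_two).1 this
    have : s.card ≤ n := by simpa using s.card_le_univ
    omega
  have h4 : 2 * (2 * k) ≤ n := by
    have hk := hC.le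
    obtain ⟨s, -, hs⟩ := Finset.exists_subset_card_eq (s := (Finset.univ : Finset (Fin n)))
      -- Whether `2 * k ≤ n` is not yet known. If it failed, taking all qubits would give `n = 0`,
      -- hence `k = 0` by `hk`.
      (n := min n (2 * k)) (by simp)
    have := hcard (s := s) (by omega)
    omega
  exact ⟨h4, fun s hs => isMaximallyEntangled_of_reducedDensity_eq (by omega) hV
    fun v hv hn => hρ hs.le hv hn⟩

/-- The product of the two strings lives on at most `2 * k` qubits and is traceless wherever the
labels differ, so its expectations vanish on `V`. -/
theorem IsTotallyEntangled.isOrtho_map_pauliString {V : Submodule ℂ (Qubits n)}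
    (h : IsTotallyEntangled (2 * k) V) {f g : Fin n → Fin 4} (hf : weight f ≤ k)
    (hg : weight g ≤ k) (hfg : f ≠ g) :
    V.map (op (pauliString f)) ⟂ V.map (op (pauliString g)) := by
  rw [Submodule.isOrtho_iff_inner_eq]
  rintro _ ⟨v, hv, rfl⟩ _ ⟨w, hw, rfl⟩
  obtain ⟨s, hs, -, hcard⟩ := Finset.exists_subsuperset_card_eq
    (s := (Finset.univ.filter fun p => f p ≠ 0) ∪ Finset.univ.filter fun p => g p ≠ 0)
    (n := 2 * k) (Finset.subset_univ _)
    ((Finset.card_union_le _ _).trans (by change weight f + weight g ≤ _; omega))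
    (by have := h.1; simp; omega)
  have hs0 : ∀ p ∉ s, f p = 0 ∧ g p = 0 := by
    intro p hp
    constructor <;> by_contra hne <;> exact hp (hs (by simp [hne]))
  rw [inner_op_left (pauliString_isHermitian f), ← op_mul_apply, pauliString, pauliString,
    tensor_mul]
  refine inner_map_eq_zero_of_mem (fun v hv hn => ?_) hv hw
  refine inner_op_tensor_of_reducedDensity_eq (h.reducedDensity_eq hcard hv hn)
    (fun p hp => by simp [hs0 p hp, pauli_zero]) ?_
  obtain ⟨p, hp⟩ := Function.ne_iff.1 hfg
  refine ⟨p, ?_, by simp [trace_pauli_mul, hp]⟩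
  by_contra hps
  exact hp (by simp [hs0 p hps])

/-- A norm-preserving involution that exchanges two subspaces, as an isometry between them. -/
def isometryOfInvolution {E : Type*} [NormedAddCommGroup E] [InnerProductSpace ℂ E] (A : E →ₗ[ℂ] E)
    (hA : ∀ v, A (A v) = v) (hn : ∀ v, ‖A v‖ = ‖v‖) (W W' : Submodule ℂ E)
    (h : ∀ w ∈ W, A w ∈ W') (h' : ∀ w ∈ W', A w ∈ W) : W ≃ₗᵢ[ℂ] W' where
  toLinearEquiv := LinearEquiv.ofLinearMap (A.restrict h) (A.restrict h')
    (by ext w; simp [hA]) (by ext w; simp [hA])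
  norm_map' w := hn w

theorem exists_linearIsometry_range_eq {V : Submodule ℂ (Qubits n)}
    (hV : Module.finrank ℂ V = 2 ^ l) :
    ∃ T : Qubits l →ₗᵢ[ℂ] Qubits n, LinearMap.range T.toLinearMap = V := by
  let b : OrthonormalBasis (Fin l → Fin 2) ℂ V := (stdOrthonormalBasis ℂ V).reindex
    (Fintype.equivOfCardEq (by simp [hV]))
  refine ⟨V.subtypeₗᵢ.comp b.repr.symm.toLinearIsometry, ?_⟩
  ext v
  constructor
  · rintro ⟨x, rfl⟩
    exact (b.repr.symm x).2
  · intro hv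
    exact ⟨b.repr ⟨v, hv⟩, by simp⟩

/-- The Pauli operators of weight at most `k` can be enumerated, starting with the identity. -/
theorem exists_enumeration_weight_le (n k : ℕ) :
    ∃ (d : ℕ) (e : Fin (d + 1) ≃ {f : Fin n → Fin 4 // weight f ≤ k}), (e 0 : Fin n → Fin 4) = 0 := by
  let z : {f : Fin n → Fin 4 // weight f ≤ k} := ⟨0, by simp [weight]⟩
  have hpos : 0 < Fintype.card {f : Fin n → Fin 4 // weight f ≤ k} := Fintype.card_pos_iff.2 ⟨z⟩
  obtain ⟨d, hd⟩ := Nat.exists_eq_succ_of_ne_zero hpos.ne'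
  let e := (Fintype.equivFinOfCardEq hd).symm
  -- The swap moves the identity to label `0`.
  exact ⟨d, (Equiv.swap 0 (e.symm z)).trans e, by simp [z]⟩

theorem orthogonalProjectionOnto_eq_of_pairwise_isOrtho {E ι : Type*} [NormedAddCommGroup E]
    [InnerProductSpace ℂ E] [FiniteDimensional ℂ E] [Fintype ι] {W : ι → Submodule ℂ E}
    (hW : Pairwise fun a b => W a ⟂ W b) {u : ι → E} (hu : ∀ i, u i ∈ W i) (j : ι) :
    ((W j).orthogonalProjectionOnto (∑ i, u i) : E) = u j := by
  classical
  refine ((W j).eq_starProjection_of_mem_of_inner_eq_zero (hu j) fun w hw => ?_)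
  rw [← Finset.add_sum_erase _ _ (Finset.mem_univ j), add_sub_cancel_left, sum_inner]
  exact Finset.sum_eq_zero fun i hi =>
    Submodule.isOrtho_iff_inner_eq.1 (hW (Finset.ne_of_mem_erase hi)) _ (hu i) _ hw

theorem IsTotallyEntangled.exists_isOrthogonal {V : Submodule ℂ (Qubits n)}
    (hV : Module.finrank ℂ V = 2 ^ l) (h : IsTotallyEntangled (2 * k) V) :
    ∃ (d : ℕ) (C : ErrorCorrectingCode n l k d), C.IsOrthogonal ∧ C.V 0 = V := by
  obtain ⟨T, hT⟩ := exists_linearIsometry_range_eq hV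
  obtain ⟨d, e, he⟩ := exists_enumeration_weight_le n k
  have hk : k ≤ n := by have := h.1; omega
  let S (j : Fin (d + 1)) : Matrix (Fin n → Fin 2) (Fin n → Fin 2) ℂ := pauliString (e j).1
  let W (j : Fin (d + 1)) : Submodule ℂ (Qubits n) := V.map (op (S j))
  have hS0 : S 0 = 1 := by simp only [S, he, pauliString_zero]
  have hW0 : W 0 = V := by
    simp only [W, hS0, op, Matrix.toLpLin_one, Submodule.map_id]
  have hSS : Set.range S = pauliErrors n k := by
    rw [pauliErrors_eq hk]
    ext M
    constructor
    · rintro ⟨j, rfl⟩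
      exact ⟨_, (e j).2, rfl⟩
    · rintro ⟨f, hf, rfl⟩
      exact ⟨e.symm ⟨f, hf⟩, by simp [S]⟩
  have hortho : Pairwise fun a b => W a ⟂ W b := fun a b hab =>
    h.isOrtho_map_pauliString (e a).2 (e b).2 fun hab' => hab (e.injective (Subtype.ext hab'))
  have hmem (j) (v : Qubits n) (hv : v ∈ V) : op (S j) v ∈ W j := Submodule.mem_map_of_mem hv
  -- The coefficients do not depend on `v`, so projecting onto `W j` isolates `c j • op (S j) v`.
  have hexp (i : Fin k ↪o Fin n) (X : Matrix (Fin k → Fin 2) (Fin k → Fin 2) ℂ) :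
      ∃ c : Fin (d + 1) → ℂ, ∀ v, op (onQubits i X) v = ∑ j, c j • op (S j) v := by
    have := onQubits_mem_span i X
    rw [← hSS, Submodule.mem_span_range_iff_exists_fun] at this
    obtain ⟨c, hc⟩ := this
    refine ⟨c, fun v => ?_⟩
    rw [← hc]
    simp only [op, map_sum, map_smul, LinearMap.sum_apply, LinearMap.smul_apply]
  let U (j : Fin (d + 1)) : W j ≃ₗᵢ[ℂ] W 0 :=
    isometryOfInvolution (op (S j)) (op_pauliString_op _) (norm_op_pauliString _) (W j) (W 0)
      (by rintro _ ⟨v, hv, rfl⟩; rw [hW0, op_pauliString_op]; exact hv)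
      (by rw [hW0]; exact hmem j)
  have hU (j) (w : W j) : (U j w : Qubits n) = op (S j) w := rfl
  refine ⟨d, ⟨T, W, hW0.trans hT.symm, hortho, U, ?_, ?_, ?_⟩, ⟨S, ?_, hSS, hS0, ?_⟩, hW0⟩
  · ext1 w
    apply Subtype.ext
    rw [hU, hS0]
    simp
  · intro i X v hv
    rw [hW0] at hv
    obtain ⟨c, hc⟩ := hexp i X
    rw [hc]
    exact Submodule.sum_mem _ fun j _ => Submodule.smul_mem _ _ <|
      Submodule.mem_iSup_of_mem j (hmem j v hv)
  · intro i X v hv hn j hj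
    rw [hW0] at hv
    obtain ⟨c, hc⟩ := hexp i X
    have hp : ((W j).orthogonalProjectionOnto (op (onQubits i X) v) : Qubits n) =
        c j • op (S j) v := by
      rw [hc]
      exact orthogonalProjectionOnto_eq_of_pairwise_isOrtho (u := fun j => c j • op (S j) v) hortho
        (fun j => Submodule.smul_mem _ _ (hmem j v hv)) j
    have hnorm : ‖(W j).orthogonalProjectionOnto (op (onQubits i X) v)‖ = ‖c j‖ := by
      rw [Submodule.coe_norm, hp, norm_smul, norm_op_pauliString, hn, mul_one]
    have hc0 : c j ≠ 0 := by
      rw [← norm_ne_zero_iff, ← hnorm]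
      exact norm_ne_zero_iff.2 hj
    -- The phase of `c j`, which is all that remains once `S j` undoes itself.
    refine ⟨((‖c j‖⁻¹ : ℝ) : ℂ) * c j, ?_, ?_⟩
    · rw [norm_mul, Complex.norm_real, norm_inv, norm_norm,
        inv_mul_cancel₀ (norm_ne_zero_iff.2 hc0)]
    · rw [hU, hnorm, Submodule.coe_smul, hp, map_smul, map_smul, op_pauliString_op, smul_smul]
  · exact fun a b hab => e.injective (Subtype.ext (pauliString_injective hab))
  · intro j
    change W j = (W 0).map _
    rw [hW0]

end Qubits

theorem proposition8 (n l k : ℕ) (V : Submodule ℂ (Qubits n))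
    (hV : Module.finrank ℂ V = 2 ^ l) :
    (∃ (d : ℕ) (C : Qubits.ErrorCorrectingCode n l k d), C.IsOrthogonal ∧ C.V 0 = V) ↔
      Qubits.IsTotallyEntangled (2 * k) V := by
  refine ⟨?_, fun h => h.exists_isOrthogonal hV⟩
  rintro ⟨d, C, hC, rfl⟩
  refine hC.isTotallyEntangled ?_
  intro h
  rw [h, finrank_bot] at hV
  exact absurd hV (by positivity)
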